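/- Let $g\ge 0$. Let $W_{gc}$ be the set of arrays of complex numbers $(H^j_k)_{j,k\in\mathbb Z}$ with $H^j_k=0$ whenever $j$ or $k$ is even, $j<2g+1$, or $k<1-2g$, which satisfy the associativity conditions $$H^{2j+1}_{2(l+k)+1}-H^{2(j+k)+1}_{2l+1}-\sum_{s=-g}^{k-1}H^{2j+1}_{2s+1}H^{2(k-s)-1}_{2l+1}=0\qquad(j\ge g,\ k\ge 0,\ l\ge -g),$$ $$H^{2j+1}_{2(l+k)+1}+H^{2k+1}_{2(l+j)+1}+\sum_{s=-g}^{-1}H^{2j+1}_{2s+1}H^{2k+1}_{2(l-s)-1}+\sum_{r=-g}^{-1}H^{2k+1}_{2r+1}H^{2j+1}_{2(l-r)-1}+\sum_{s=0}^{l-1}H^{2j+1}_{2s+1}H^{2k+1}_{2(l-s)-1}=0\qquad(j,k\ge g,\ l\ge 1).$$ (These say that the linear span of the $z^{2n}$, $n\ge0$, and of the series $p_{2j+1}(z)=z^{2j+1}+\sum_{m\ge -g}H^{2j+1}_{2m+1}z^{-(2m+1)}$, $j\ge g$, is closed under multiplication.) Let $\mathbb K=\mathbb R$ or $\mathbb C$,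 let $U\subset\mathbb K^{2g+1}$ be open with coordinates $x=(x_{2g+1},x_{2g+3},\dots,x_{6g+1})$, and let $x\mapsto (H^j_k(x))\in W_{gc}$ be a map on $U$ whose components are continuously differentiable over $\mathbb K$ (so holomorphic if $\mathbb K=\mathbb C$). For odd $i\ge 1-2g$ put $$\omega_i=\sum_{k=0}^{2g}H^{2(g+k)+1}_i\,dx_{2(g+k)+1},\qquad \omega(z)=\sum_{k=0}^{2g}p_{2(g+k)+1}(z)\,dx_{2(g+k)+1},$$ where $\omega(z)$ is a formal Laurent series in $z^{-1}$ whose coefficients are one-forms on $U$; it is called closed if all its coefficients are closed, and derivatives in $x$ of Laurent series are taken coefficientwise. Then: 1. If the $2g+1$ one-forms $\omega_i$, $i=1-2g,3-2g,\dots,2g+1$, are closed on $U$, then $\omega_i$ is closed on $U$ for all $i=2g+3,2g+5,\dots$. 2. The $2g+1$ one-forms $\omega_i$, $i=1-2g,3-2g,\dots,2g+1$, are closed on $U$ if and only if $\omega(z)$ is closed on $U$. 3. If these $2g+1$ one-forms are closed on $U$, then every point of $U$ has an open neighbourhood $V\subset U$ on which there are functions $S_i:V\to\mathbb C$, $i=1-2g,3-2g,\dots$,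 such that the formal Laurent series $$S(x,z)=\sum_{k=g}^{3g}z^{2k+1}x_{2k+1}+\sum_{l=1}^{g}z^{2l-1}S_{1-2l}(x)+\sum_{m=0}^{\infty}\frac{S_{2m+1}(x)}{z^{2m+1}}$$ satisfies $\omega(z)=dS(x,z)$ on $V$; that is, $p_{2j+1}(z)=\partial S(x,z)/\partial x_{2j+1}$ for $j=g,\dots,3g$, and $H^{2j+1}_i=\partial S_i/\partial x_{2j+1}$ for $j=g,\dots,3g$ and all odd $i\ge 1-2g$. -/

import Mathlib

noncomputable section

namespace BirkhoffStratum

/-- The points of the variety `W_{gc}`: arrays of complex numbers `H j k` (standing for `H^j_k`), the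
structure coefficients of the canonical basis
`p_{2m} = z^{2m}`, `p_{2j+1} = z^{2j+1} + ∑_{m ≥ -g} H^{2j+1}_{2m+1} / z^{2m+1}` (`j ≥ g`),
subject to the quadratic associativity conditions. The array is extended by `0` to all the pairs of
integers that do not label a coefficient of some `p_{2j+1}`, `j ≥ g`. -/
structure IsPointWgc (g : ℕ) (H : ℤ → ℤ → ℂ) : Prop where
  even_upper : ∀ j k : ℤ, Even j → H j k = 0
  even_lower : ∀ j k : ℤ, Even k → H j k = 0
  upper_small : ∀ j k : ℤ, j < 2 * (g : ℤ) + 1 → H j k = 0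
  lower_small : ∀ j k : ℤ, k < 1 - 2 * (g : ℤ) → H j k = 0
  /-- The coefficient of `z^{-(2l+1)}` in `z^{2k} p_{2j+1} = p_{2(j+k)+1} + ∑ H p`. -/
  assoc_even_odd : ∀ j k l : ℤ, (g : ℤ) ≤ j → 0 ≤ k → -(g : ℤ) ≤ l →
    H (2 * j + 1) (2 * (l + k) + 1) - H (2 * (j + k) + 1) (2 * l + 1)
      - ∑ s ∈ Finset.Ico (-(g : ℤ)) k,
          H (2 * j + 1) (2 * s + 1) * H (2 * (k - s) - 1) (2 * l + 1) = 0
  /-- The coefficient of `z^{-2l}` in `p_{2j+1} p_{2k+1}`, which is a polynomial in `z^2`. -/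
  assoc_odd_odd : ∀ j k l : ℤ, (g : ℤ) ≤ j → (g : ℤ) ≤ k → 1 ≤ l →
    H (2 * j + 1) (2 * (l + k) + 1) + H (2 * k + 1) (2 * (l + j) + 1)
      + ∑ s ∈ Finset.Ico (-(g : ℤ)) 0, H (2 * j + 1) (2 * s + 1) * H (2 * k + 1) (2 * (l - s) - 1)
      + ∑ r ∈ Finset.Ico (-(g : ℤ)) 0, H (2 * k + 1) (2 * r + 1) * H (2 * j + 1) (2 * (l - r) - 1)
      + ∑ s ∈ Finset.Ico (0 : ℤ) l, H (2 * j + 1) (2 * s + 1) * H (2 * k + 1) (2 * (l - s) - 1) = 0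

/-- The formal series `∑ a_n z^{-n}` over the odd `n ≥ 1 - 2g`. Laurent series are series in the
variable `z⁻¹`: the coefficient with index `n` is the coefficient of `z^{-n}`. -/
def oddTail (g : ℕ) (a : ℤ → ℂ) : LaurentSeries ℂ :=
  HahnSeries.ofSuppBddBelow (fun n : ℤ => if Odd n ∧ 1 - 2 * (g : ℤ) ≤ n then a n else 0)
    ⟨1 - 2 * (g : ℤ), by
      intro n hn
      by_contra hlt
      exact hn (if_neg fun h => hlt h.2)⟩

/-- `p_j(z) = z^j + ∑_{m ≥ -g} H^j_{2m+1} / z^{2m+1}`, for odd `j ≥ 2g+1`. -/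
def p (g : ℕ) (H : ℤ → ℤ → ℂ) (j : ℤ) : LaurentSeries ℂ :=
  HahnSeries.single (-j) 1 + oddTail g (H j)

/-- The odd number `2(g+k)+1`. The coordinate with index `k = 0, …, 2g` of `x` is `x_{2(g+k)+1}`. -/
def idx (g : ℕ) (k : Fin (2 * g + 1)) : ℤ := 2 * ((g : ℤ) + (k : ℕ)) + 1

section Forms

variable {𝕜 : Type*} [RCLike 𝕜] [NormedAlgebra 𝕜 ℂ]

/-- The value `∑_k a_k dx_k` of a complex one-form at a point of `𝕜^m`. -/
def coordForm {m : ℕ} (a : Fin m → ℂ) : (Fin m → 𝕜) →L[𝕜] ℂ :=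
  ∑ k, (ContinuousLinearMap.proj (R := 𝕜) (φ := fun _ : Fin m => 𝕜) k).smulRight (a k)

/-- The exterior derivative of the one-form `ω` vanishes on `U`. -/
def IsClosedOneFormOn {m : ℕ} (ω : (Fin m → 𝕜) → (Fin m → 𝕜) →L[𝕜] ℂ) (U : Set (Fin m → 𝕜)) :
    Prop :=
  ∀ x ∈ U, extDeriv
    (fun y => ContinuousAlternatingMap.ofSubsingleton 𝕜 (Fin m → 𝕜) ℂ (0 : Fin 1) (ω y)) x = 0

/-- The one-form `ω_i = ∑_{k=0}^{2g} H^{2(g+k)+1}_i dx_{2(g+k)+1}`. -/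
def omega (g : ℕ) (H : (Fin (2 * g + 1) → 𝕜) → ℤ → ℤ → ℂ) (i : ℤ) (x : Fin (2 * g + 1) → 𝕜) :
    (Fin (2 * g + 1) → 𝕜) →L[𝕜] ℂ :=
  coordForm fun k => H x (idx g k) i

/-- The formal one-form `ω(z) = ∑_{k=0}^{2g} p_{2(g+k)+1}(z) dx_{2(g+k)+1}`, given by its
coefficients: `omegaZ g H n` is the one-form at `z^{-n}`. -/
def omegaZ (g : ℕ) (H : (Fin (2 * g + 1) → 𝕜) → ℤ → ℤ → ℂ) (n : ℤ) (x : Fin (2 * g + 1) → 𝕜) :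
    (Fin (2 * g + 1) → 𝕜) →L[𝕜] ℂ :=
  coordForm fun k => (p g (H x) (idx g k)).coeff n

/-- The action
`S(x,z) = ∑_{k=g}^{3g} z^{2k+1} x_{2k+1} + ∑_{l=1}^{g} z^{2l-1} S_{1-2l}(x)
  + ∑_{m ≥ 0} S_{2m+1}(x) / z^{2m+1}`;
the last two sums are the sum of `S_n z^{-n}` over the odd `n ≥ 1 - 2g`. -/
def action (g : ℕ) (S : ℤ → (Fin (2 * g + 1) → 𝕜) → ℂ) (x : Fin (2 * g + 1) → 𝕜) :
    LaurentSeries ℂ :=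
  ∑ k, HahnSeries.single (-idx g k) (algebraMap 𝕜 ℂ (x k)) + oddTail g (fun n => S n x)

end Forms

end BirkhoffStratum

end

/-!
The algebra spanned by the `z^{2n}` and the `p_{2j+1}` is the coordinate ring of a plane curve
`y² = F(z²)` with `y = p_{2g+1}`: every
`p_{2j+1}` is a multiple `A_j p_{2g+1}` by a polynomial `A_j` in `z²`
(`IsPointWgc.exists_p_eq_mul`), and the product of two of the `p_{2j+1}` is a polynomial in `z²`
(`IsPointWgc.p_mul_p_mem`); in particular so is `F = p_{2g+1}²`. Hence, coefficientwise in `x`,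
`p_{2g+1} dp_{2j+1} = d(p_{2g+1} p_{2j+1}) - ½ A_j dF` has polynomials in `z²` as components
(`p_mul_pDeriv_mem`), and therefore so has `p_{2g+1} dω(z)`.

If the first `2g+1` of the forms `ω_i` are closed, then `dω(z) = O(z^{-2g-3})`, so
`p_{2g+1} dω(z) = O(z⁻²)`. A polynomial in `z²` of this order vanishes, and the Laurent series form
a domain, so `dω(z) = 0` (`eq_zero_of_p_mul_mem`, `isClosedOneFormOn_omega_of_low`). The coefficients
of `ω(z)` other than the `ω_i` are constant.

The function `S` comes from the Poincaré lemma, applied to all the `ω_i` on one and the same ball.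
-/

namespace BirkhoffStratum

open HahnSeries

/-! ### Polynomials in `z²` and coefficients of Laurent series -/

/-- The polynomials in `z²`, as a subring of the Laurent series in `z⁻¹`. -/
def evenPolynomials : Subring (LaurentSeries ℂ) where
  carrier := {f | ∀ n, f.coeff n ≠ 0 → Even n ∧ n ≤ 0}
  mul_mem' := by
    intro a b ha hb n hn
    rw [HahnSeries.coeff_mul] at hn
    obtain ⟨ij, hij, hne⟩ := Finset.exists_ne_zero_of_sum_ne_zero hn
    rw [Finset.mem_antidiagonal] at hij
    obtain ⟨he, hle⟩ := ha _ hij.1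
    obtain ⟨he', hle'⟩ := hb _ hij.2.1
    rw [← hij.2.2]
    exact ⟨he.add he', by lia⟩
  add_mem' := by
    intro a b ha hb n hn
    by_cases h : a.coeff n = 0
    · exact hb n fun h' => hn (by simp [h, h'])
    · exact ha n h
  zero_mem' := fun n hn => absurd HahnSeries.coeff_zero hn
  one_mem' := by
    intro n hn
    have : n = 0 := by
      by_contra h
      exact hn (HahnSeries.coeff_single_of_ne h)
    simp [this]
  neg_mem' := by
    intro a ha n hn
    exact ha n fun h => hn (by simp [h])

lemma C_mem_evenPolynomials (c : ℂ) : HahnSeries.C c ∈ evenPolynomials := by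
  intro n hn
  have : n = 0 := by
    by_contra h
    exact hn (HahnSeries.coeff_single_of_ne h)
  simp [this]

lemma coeff_C_mul (c : ℂ) (f : LaurentSeries ℂ) (n : ℤ) :
    (HahnSeries.C c * f).coeff n = c * f.coeff n := by
  rw [HahnSeries.C_apply, HahnSeries.coeff_single_mul, sub_zero]

lemma coeff_oddTail (g : ℕ) (a : ℤ → ℂ) (n : ℤ) :
    (oddTail g a).coeff n = if Odd n ∧ 1 - 2 * (g : ℤ) ≤ n then a n else 0 := rfl

lemma coeff_p (g : ℕ) (H : ℤ → ℤ → ℂ) (j n : ℤ) :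
    (p g H j).coeff n =
      (if n = -j then 1 else 0) + if Odd n ∧ 1 - 2 * (g : ℤ) ≤ n then H j n else 0 := by
  rw [p, HahnSeries.coeff_add, coeff_oddTail, HahnSeries.coeff_single]
  congr

/-- A coefficient of a product as a sum whose range depends only on lower bounds of the supports
of the factors, so that it can be differentiated term by term. -/
lemma coeff_mul_eq_sum_Icc {R : Type*} [Semiring R] {f h : LaurentSeries R} {N M : ℤ}
    (hf : ∀ n < N, f.coeff n = 0) (hh : ∀ n < M, h.coeff n = 0) (n : ℤ) :
    (f * h).coeff n = ∑ i ∈ Finset.Icc N (n - M), f.coeff i * h.coeff (n - i) := by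
  rw [HahnSeries.coeff_mul]
  refine Finset.sum_bij_ne_zero (fun ij _ _ => ij.1) ?_ ?_ ?_ ?_
  · rintro ⟨i, j⟩ hij hne
    rw [Finset.mem_antidiagonal] at hij
    dsimp only at hij hne ⊢
    have h1 : ¬ i < N := fun h => hij.1 (hf i h)
    have h2 : ¬ j < M := fun h => hij.2.1 (hh j h)
    rw [Finset.mem_Icc]
    lia
  · rintro ⟨i, j⟩ hij _ ⟨i', j'⟩ hij' _ h
    rw [Finset.mem_antidiagonal] at hij hij'
    dsimp only at hij hij' h
    ext <;> dsimp only <;> lia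
  · intro i _ hne
    refine ⟨(i, n - i), ?_, hne, rfl⟩
    rw [Finset.mem_antidiagonal]
    exact ⟨left_ne_zero_of_mul hne, right_ne_zero_of_mul hne, by simp⟩
  · rintro ⟨i, j⟩ hij _
    rw [Finset.mem_antidiagonal] at hij
    dsimp only at hij ⊢
    rw [← hij.2.2, add_sub_cancel_left]

/-! ### The algebra at a point of `W_{gc}` -/

section Algebra

variable {g : ℕ} {H : ℤ → ℤ → ℂ}

/-- Multiplication by `z²` in the canonical basis:
`z² p_{2j+1} = p_{2j+3} + H^{2j+1}_{1-2g} p_{2g+1}`. -/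
lemma IsPointWgc.sq_mul_p (hH : IsPointWgc g H) {j : ℤ} (hj : (g : ℤ) ≤ j) :
    single (-2 : ℤ) (1 : ℂ) * p g H (2 * j + 1) =
      p g H (2 * (j + 1) + 1) + C (H (2 * j + 1) (1 - 2 * g)) * p g H (2 * g + 1) := by
  ext n
  rw [HahnSeries.coeff_single_mul, HahnSeries.coeff_add, coeff_C_mul, one_mul,
    coeff_p, coeff_p, coeff_p]
  rcases Int.even_or_odd n with hn | ⟨l, rfl⟩
  · have h1 : ¬ Odd (n - -2) := by grind
    have h2 : ¬ Odd n := by grind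
    have h3 : n - -2 ≠ -(2 * j + 1) := by grind
    have h4 : n ≠ -(2 * (j + 1) + 1) := by grind
    have h5 : n ≠ -(2 * g + 1) := by grind
    simp only [h1, h2, h3, h4, h5, false_and, if_false, mul_zero, add_zero]
  · have hodd : Odd (2 * l + 1) := ⟨l, rfl⟩
    have hodd' : Odd (2 * l + 1 - -2) := ⟨l + 1, by ring⟩
    simp only [hodd, hodd', true_and]
    have e : (2 * l + 1 - -2 = -(2 * j + 1)) ↔ (2 * l + 1 = -(2 * (j + 1) + 1)) := by lia
    simp only [e]
    by_cases hl : -(g : ℤ) ≤ l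
    · have key := hH.assoc_even_odd j 1 l hj zero_le_one hl
      -- only the summand `s = -g` survives, as `p_{1-2s}` is a basis element only for `-s ≥ g`
      rw [Finset.sum_eq_single_of_mem (-(g : ℤ)) (by simp; lia)
        (fun s hs hne => by
          rw [Finset.mem_Ico] at hs
          rw [hH.upper_small (2 * (1 - s) - 1) _ (by lia), mul_zero])] at key
      have e1 : 2 * (l + 1) + 1 = 2 * l + 1 - -2 := by ring
      have e2 : 2 * -(g : ℤ) + 1 = 1 - 2 * g := by ring
      have e3 : 2 * (1 - -(g : ℤ)) - 1 = 2 * g + 1 := by ring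
      rw [e1, e2, e3] at key
      rw [if_pos (by lia : 1 - 2 * (g : ℤ) ≤ 2 * l + 1 - -2),
        if_pos (by lia : 1 - 2 * (g : ℤ) ≤ 2 * l + 1), if_pos (by lia : 1 - 2 * (g : ℤ) ≤ 2 * l + 1),
        if_neg (by lia : 2 * l + 1 ≠ -(2 * (g : ℤ) + 1))]
      linear_combination key
    · rw [if_neg (by lia : ¬ 1 - 2 * (g : ℤ) ≤ 2 * l + 1),
        if_neg (by lia : ¬ 1 - 2 * (g : ℤ) ≤ 2 * l + 1)]
      by_cases hl' : l = -(g : ℤ) - 1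
      · subst hl'
        rw [if_pos (by lia : 1 - 2 * (g : ℤ) ≤ 2 * (-(g : ℤ) - 1) + 1 - -2),
          if_pos (by lia : 2 * (-(g : ℤ) - 1) + 1 = -(2 * (g : ℤ) + 1))]
        have e1 : 2 * (-(g : ℤ) - 1) + 1 - -2 = 1 - 2 * g := by ring
        rw [e1]
        ring
      · rw [if_neg (by lia : ¬ 1 - 2 * (g : ℤ) ≤ 2 * l + 1 - -2),
          if_neg (by lia : ¬ 2 * l + 1 = -(2 * (g : ℤ) + 1))]
        ring

/-- The odd part of the algebra is generated by `p_{2g+1}` over the polynomials in `z²`. -/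
lemma IsPointWgc.exists_p_eq_mul (hH : IsPointWgc g H) {j : ℤ} (hj : (g : ℤ) ≤ j) :
    ∃ A ∈ evenPolynomials, p g H (2 * j + 1) = A * p g H (2 * g + 1) := by
  induction j, hj using Int.leInduction with
  | base => exact ⟨1, one_mem _, (one_mul _).symm⟩
  | succ j hj ih =>
    obtain ⟨A, hA, hpA⟩ := ih
    have hz : single (-2 : ℤ) (1 : ℂ) ∈ evenPolynomials := by
      intro n hn
      have : n = -2 := by
        by_contra h
        exact hn (HahnSeries.coeff_single_of_ne h)
      subst this
      exact ⟨by decide, by decide⟩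
    refine ⟨single (-2 : ℤ) (1 : ℂ) * A
      - C (H (2 * j + 1) (1 - 2 * g)),
      sub_mem (mul_mem hz hA) (C_mem_evenPolynomials _), ?_⟩
    have := hH.sq_mul_p hj
    linear_combination -this + single (-2 : ℤ) (1 : ℂ) * hpA

lemma coeff_p_eq_zero_of_even {j n : ℤ} (hj : Odd j) (hn : Even n) : (p g H j).coeff n = 0 := by
  rw [coeff_p, if_neg (by grind), if_neg (by grind), add_zero]

lemma coeff_oddTail_of_lt (a : ℤ → ℂ) {n : ℤ} (hn : n < 1 - 2 * (g : ℤ)) :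
    (oddTail g a).coeff n = 0 := by
  rw [coeff_oddTail, if_neg (by lia)]

lemma coeff_p_of_lt {j n : ℤ} (hj : 2 * (g : ℤ) + 1 ≤ j) (hn : n < -j) : (p g H j).coeff n = 0 := by
  rw [coeff_p, if_neg (by lia), if_neg (by lia), add_zero]

/-- The sum over odd indices `a + b = 2l` of the products of two tails. -/
lemma coeff_oddTail_mul_oddTail (a b : ℤ → ℂ) (l : ℤ) :
    (oddTail g a * oddTail g b).coeff (2 * l) =
      ∑ s ∈ Finset.Ico (-(g : ℤ)) (l + g), a (2 * s + 1) * b (2 * (l - s) - 1) := by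
  rw [coeff_mul_eq_sum_Icc (fun n => coeff_oddTail_of_lt a) (fun n => coeff_oddTail_of_lt b)]
  symm
  refine Finset.sum_bij_ne_zero (fun s _ _ => 2 * s + 1) ?_ ?_ ?_ ?_
  · intro s hs _
    rw [Finset.mem_Ico] at hs
    rw [Finset.mem_Icc]
    lia
  · intro s _ _ t _ _ h
    lia
  · intro i hi hne
    rw [Finset.mem_Icc] at hi
    rw [coeff_oddTail, coeff_oddTail] at hne
    have hio : Odd i := by
      by_contra h
      exact hne (by simp [h])
    obtain ⟨s, rfl⟩ := hio
    refine ⟨s, by rw [Finset.mem_Ico]; lia, ?_, rfl⟩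
    rw [if_pos ⟨⟨s, rfl⟩, by lia⟩, if_pos ⟨⟨l - s - 1, by ring⟩, by lia⟩] at hne
    convert! hne using 3
    ring
  · intro s hs _
    rw [Finset.mem_Ico] at hs
    rw [coeff_oddTail, coeff_oddTail, if_pos ⟨⟨s, rfl⟩, by lia⟩,
      if_pos ⟨⟨l - s - 1, by ring⟩, by lia⟩]
    congr 2
    ring

/-- The product of two odd basis elements is a polynomial in `z²`. -/
lemma IsPointWgc.p_mul_p_mem (hH : IsPointWgc g H) {j k : ℤ} (hj : (g : ℤ) ≤ j)
    (hk : (g : ℤ) ≤ k) : p g H (2 * j + 1) * p g H (2 * k + 1) ∈ evenPolynomials := by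
  intro n hn
  rcases Int.even_or_odd n with he | ho
  · refine ⟨he, ?_⟩
    by_contra hpos
    obtain ⟨l, rfl⟩ := he.exists_two_nsmul
    rw [nsmul_eq_mul, Nat.cast_ofNat] at hn hpos
    apply hn
    have key := hH.assoc_odd_odd j k l hj hk (by lia)
    have hsplit : ∑ s ∈ Finset.Ico (-(g : ℤ)) (l + g),
          H (2 * j + 1) (2 * s + 1) * H (2 * k + 1) (2 * (l - s) - 1) =
        ∑ s ∈ Finset.Ico (-(g : ℤ)) 0, H (2 * j + 1) (2 * s + 1) * H (2 * k + 1) (2 * (l - s) - 1)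
        + ∑ r ∈ Finset.Ico (-(g : ℤ)) 0, H (2 * k + 1) (2 * r + 1) * H (2 * j + 1) (2 * (l - r) - 1)
        + ∑ s ∈ Finset.Ico (0 : ℤ) l,
          H (2 * j + 1) (2 * s + 1) * H (2 * k + 1) (2 * (l - s) - 1) := by
      -- the summands with `s ≥ l` are reindexed by `r = l - 1 - s`
      have hrefl : ∑ r ∈ Finset.Ico (-(g : ℤ)) 0,
            H (2 * k + 1) (2 * r + 1) * H (2 * j + 1) (2 * (l - r) - 1) =
          ∑ s ∈ Finset.Ico l (l + g),
            H (2 * j + 1) (2 * s + 1) * H (2 * k + 1) (2 * (l - s) - 1) := by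
        refine Finset.sum_nbij' (fun r => l - 1 - r) (fun s => l - 1 - s) ?_ ?_ ?_ ?_ ?_
        · intro r hr; rw [Finset.mem_Ico] at hr ⊢; lia
        · intro r hr; rw [Finset.mem_Ico] at hr ⊢; lia
        · intro r _; ring
        · intro r _; ring
        · intro r _
          rw [mul_comm]
          congr 2 <;> ring
      rw [hrefl, ← Finset.Ico_union_Ico_eq_Ico (by lia : -(g : ℤ) ≤ 0) (by lia : (0 : ℤ) ≤ l + g),
        Finset.sum_union (Finset.Ico_disjoint_Ico_consecutive _ _ _),
        ← Finset.Ico_union_Ico_eq_Ico (by lia : (0 : ℤ) ≤ l) (by lia : l ≤ l + g),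
        Finset.sum_union (Finset.Ico_disjoint_Ico_consecutive _ _ _)]
      ring
    rw [p, p, add_mul, mul_add, mul_add, HahnSeries.coeff_add, HahnSeries.coeff_add,
      HahnSeries.coeff_add, coeff_oddTail_mul_oddTail, hsplit, HahnSeries.coeff_single_mul,
      HahnSeries.coeff_single_mul, HahnSeries.coeff_mul_single, coeff_oddTail, coeff_oddTail,
      HahnSeries.coeff_single_of_ne (by lia),
      if_pos ⟨⟨l + j, by ring⟩, by lia⟩, if_pos ⟨⟨l + k, by ring⟩, by lia⟩]
    have e1 : 2 * l - -(2 * j + 1) = 2 * (l + j) + 1 := by ring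
    have e2 : 2 * l - -(2 * k + 1) = 2 * (l + k) + 1 := by ring
    rw [e1, e2]
    linear_combination key
  · exfalso
    apply hn
    rw [HahnSeries.coeff_mul]
    refine Finset.sum_eq_zero ?_
    rintro ⟨a, b⟩ hab
    rw [Finset.mem_antidiagonal] at hab
    obtain ⟨-, -, hab⟩ := hab
    dsimp only at hab ⊢
    rcases Int.even_or_odd a with ha | ha
    · rw [coeff_p_eq_zero_of_even ⟨j, rfl⟩ ha, zero_mul]
    · have hb : Even b := by grind
      rw [coeff_p_eq_zero_of_even ⟨k, rfl⟩ hb, mul_zero]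

lemma p_ne_zero {j : ℤ} (hj : 2 * (g : ℤ) + 1 ≤ j) : p g H j ≠ 0 := by
  intro h
  have := congrArg (fun f => f.coeff (-j)) h
  simp only [coeff_p] at this
  rw [if_neg (by lia : ¬(Odd (-j) ∧ 1 - 2 * (g : ℤ) ≤ -j))] at this
  simp at this

/-- If `p_{2g+1} f` is a polynomial in `z²` and `f = O(z^{-2g-3})`, then `p_{2g+1} f = O(z⁻²)`
vanishes, and hence so does `f`. -/
lemma eq_zero_of_p_mul_mem {f : LaurentSeries ℂ} (hmem : p g H (2 * g + 1) * f ∈ evenPolynomials)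
    (hf : ∀ n < 2 * (g : ℤ) + 3, f.coeff n = 0) : f = 0 := by
  have hzero : p g H (2 * g + 1) * f = 0 := by
    ext n
    rw [HahnSeries.coeff_zero]
    by_contra hn
    have hle := (hmem n hn).2
    rw [coeff_mul_eq_sum_Icc (fun n => coeff_p_of_lt le_rfl) hf, Finset.Icc_eq_empty (by lia),
      Finset.sum_empty] at hn
    exact hn rfl
  exact (mul_eq_zero.mp hzero).resolve_left (p_ne_zero le_rfl)

end Algebra

/-! ### Differentiation in `x` and closedness of `ω(z)` -/

/-- A differentiable one-form is closed at a point if and only if its derivative there is a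
symmetric bilinear map. -/
lemma extDeriv_ofSubsingleton_eq_zero_iff {𝕜 E F : Type*} [RCLike 𝕜]
    [NormedAddCommGroup E] [NormedSpace 𝕜 E] [NormedAddCommGroup F] [NormedSpace 𝕜 F]
    {ω : E → E →L[𝕜] F} {x : E}
    (hω : DifferentiableAt 𝕜 ω x) :
    extDeriv (fun y => ContinuousAlternatingMap.ofSubsingleton 𝕜 E F (0 : Fin 1) (ω y)) x = 0 ↔
      ∀ u v, fderiv 𝕜 ω x u v = fderiv 𝕜 ω x v u := by
  have hd : DifferentiableAt 𝕜
      (fun y => ContinuousAlternatingMap.ofSubsingleton 𝕜 E F (0 : Fin 1) (ω y)) x :=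
    (ContinuousAlternatingMap.ofSubsingletonLIE (𝕜 := 𝕜) (E := E) (F := F) (0 : Fin 1)).differentiableAt.comp
      x hω
  have key : ∀ w : Fin 2 → E,
      extDeriv (fun y => ContinuousAlternatingMap.ofSubsingleton 𝕜 E F (0 : Fin 1) (ω y)) x w =
        fderiv 𝕜 ω x (w 0) (w 1) - fderiv 𝕜 ω x (w 1) (w 0) := by
    intro w
    rw [extDeriv_apply hd, Fin.sum_univ_two]
    have h (v : E) : fderiv 𝕜 (fun y => ω y v) x = (fderiv 𝕜 ω x).flip v := by
      rw [fderiv_clm_apply hω (differentiableAt_const v)]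
      simp
    simp [h, Fin.removeNth, Fin.tail, sub_eq_add_neg]
  constructor
  · intro h u v
    have := key ![u, v]
    rw [h] at this
    exact sub_eq_zero.mp this.symm
  · intro h
    ext w
    rw [key, h, sub_self]
    rfl

section Analysis

variable {𝕜 : Type*} [RCLike 𝕜] [NormedAlgebra 𝕜 ℂ]

/-- The product rule for coefficientwise derivatives of Laurent series whose supports are uniformly
bounded below. -/
lemma hasDerivAt_coeff_mul {f h : 𝕜 → LaurentSeries ℂ} {f' h' : LaurentSeries ℂ} {N M : ℤ} {t : 𝕜}
    (hf : ∀ s, ∀ n < N, (f s).coeff n = 0) (hh : ∀ s, ∀ n < M, (h s).coeff n = 0)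
    (hf0 : ∀ n < N, f'.coeff n = 0) (hh0 : ∀ n < M, h'.coeff n = 0)
    (hf' : ∀ n, HasDerivAt (fun s => (f s).coeff n) (f'.coeff n) t)
    (hh' : ∀ n, HasDerivAt (fun s => (h s).coeff n) (h'.coeff n) t) (n : ℤ) :
    HasDerivAt (fun s => (f s * h s).coeff n) ((f' * h t + f t * h').coeff n) t := by
  rw [HahnSeries.coeff_add, coeff_mul_eq_sum_Icc hf0 (hh t), coeff_mul_eq_sum_Icc (hf t) hh0,
    ← Finset.sum_add_distrib]
  have : (fun s => (f s * h s).coeff n) =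
      fun s => ∑ i ∈ Finset.Icc N (n - M), (f s).coeff i * (h s).coeff (n - i) :=
    funext fun s => coeff_mul_eq_sum_Icc (hf s) (hh s) n
  rw [this]
  exact HasDerivAt.fun_sum fun i _ => (hf' i).mul (hh' (n - i))

lemma coordForm_apply {m : ℕ} (a : Fin m → ℂ) (v : Fin m → 𝕜) :
    coordForm a v = ∑ k, algebraMap 𝕜 ℂ (v k) * a k := by
  simp [coordForm, Algebra.smul_def]

variable {g : ℕ} {U : Set (Fin (2 * g + 1) → 𝕜)} {H : (Fin (2 * g + 1) → 𝕜) → ℤ → ℤ → ℂ}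

lemma hasFDerivAt_coordForm {m : ℕ} {a : (Fin m → 𝕜) → Fin m → ℂ}
    {a' : Fin m → (Fin m → 𝕜) →L[𝕜] ℂ} {x : Fin m → 𝕜}
    (ha : ∀ k, HasFDerivAt (fun y => a y k) (a' k) x) :
    HasFDerivAt (fun y => (coordForm (a y) : (Fin m → 𝕜) →L[𝕜] ℂ))
      (∑ k, (ContinuousLinearMap.smulRightL 𝕜 (Fin m → 𝕜) ℂ
        (ContinuousLinearMap.proj (R := 𝕜) (φ := fun _ : Fin m => 𝕜) k)).comp (a' k)) x := by
  unfold coordForm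
  refine HasFDerivAt.fun_sum fun k _ => ?_
  exact (ContinuousLinearMap.smulRightL 𝕜 (Fin m → 𝕜) ℂ
    (ContinuousLinearMap.proj (R := 𝕜) (φ := fun _ : Fin m => 𝕜) k)).hasFDerivAt.comp x (ha k)

lemma differentiableAt_omega {x : Fin (2 * g + 1) → 𝕜} {i : ℤ}
    (hd : ∀ j, DifferentiableAt 𝕜 (fun y => H y j i) x) :
    DifferentiableAt 𝕜 (omega g H i) x :=
  (hasFDerivAt_coordForm fun k => (hd (idx g k)).hasFDerivAt).differentiableAt

lemma fderiv_omega_apply {x : Fin (2 * g + 1) → 𝕜} {i : ℤ}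
    (hd : ∀ j, DifferentiableAt 𝕜 (fun y => H y j i) x) (u v : Fin (2 * g + 1) → 𝕜) :
    fderiv 𝕜 (omega g H i) x u v =
      ∑ k, algebraMap 𝕜 ℂ (v k) * fderiv 𝕜 (fun y => H y (idx g k) i) x u := by
  have : HasFDerivAt (omega g H i) _ x :=
    hasFDerivAt_coordForm fun k => (hd (idx g k)).hasFDerivAt
  rw [this.fderiv]
  simp [Algebra.smul_def]

/-- The coefficientwise derivative of `p_j` at `x` in the direction `u`; the leading term `z^j` is
constant. -/
noncomputable def pDeriv (g : ℕ) (H : (Fin (2 * g + 1) → 𝕜) → ℤ → ℤ → ℂ) (j : ℤ)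
    (x u : Fin (2 * g + 1) → 𝕜) :
    LaurentSeries ℂ :=
  oddTail g fun n => fderiv 𝕜 (fun y => H y j n) x u

lemma hasDerivAt_coeff_p {x : Fin (2 * g + 1) → 𝕜} {j : ℤ}
    (hd : ∀ i, DifferentiableAt 𝕜 (fun y => H y j i) x) (u : Fin (2 * g + 1) → 𝕜) (n : ℤ) :
    HasDerivAt (fun t : 𝕜 => (p g (H (x + t • u)) j).coeff n) ((pDeriv g H j x u).coeff n) 0 := by
  simp only [coeff_p, pDeriv, coeff_oddTail]
  refine HasDerivAt.const_add _ ?_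
  split_ifs
  · exact (hd n).hasFDerivAt.hasLineDerivAt u
  · exact hasDerivAt_const _ _

/-- Since `p_{2g+1} p_{2j+1}` is a polynomial in `z²` at every point of `U`, so are its derivatives. -/
lemma deriv_p_mul_p_mem (hU : IsOpen U)
    (hd : ∀ j i, ∀ x ∈ U, DifferentiableAt 𝕜 (fun y => H y j i) x)
    (hW : ∀ x ∈ U, IsPointWgc g (H x)) {x : Fin (2 * g + 1) → 𝕜} (hx : x ∈ U) {j : ℤ}
    (hj : (g : ℤ) ≤ j) (u : Fin (2 * g + 1) → 𝕜) :
    pDeriv g H (2 * g + 1) x u * p g (H x) (2 * j + 1)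
      + p g (H x) (2 * g + 1) * pDeriv g H (2 * j + 1) x u ∈ evenPolynomials := by
  intro n hn
  by_contra hne
  apply hn
  have h0 := hasDerivAt_coeff_mul (t := (0 : 𝕜))
    (f := fun t => p g (H (x + t • u)) (2 * g + 1)) (h := fun t => p g (H (x + t • u)) (2 * j + 1))
    (fun _ n => coeff_p_of_lt le_rfl) (fun _ n => coeff_p_of_lt (by lia : 2 * (g : ℤ) + 1 ≤ 2 * j + 1))
    (fun n h => coeff_oddTail_of_lt _ (by lia)) (fun n h => coeff_oddTail_of_lt _ (by lia))
    (hasDerivAt_coeff_p (fun i => hd _ i x hx) u) (hasDerivAt_coeff_p (fun i => hd _ i x hx) u) n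
  simp only [zero_smul, add_zero] at h0
  -- the coefficient vanishes on `U`, which contains a neighbourhood of `x` in the line
  refine h0.unique ((hasDerivAt_const (0 : 𝕜) (0 : ℂ)).congr_of_eventuallyEq ?_)
  have hcont : ContinuousAt (fun t : 𝕜 => x + t • u) 0 := by fun_prop
  have : ∀ᶠ t : 𝕜 in nhds 0, x + t • u ∈ U :=
    hcont.eventually (hU.mem_nhds (by simpa using hx))
  filter_upwards [this] with t ht
  by_contra hnt
  exact hne ((hW _ ht).p_mul_p_mem le_rfl hj n hnt)

/-- With `p_{2j+1} = A p_{2g+1}`, one has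
`p_{2g+1} dp_{2j+1} = d(p_{2g+1} p_{2j+1}) - ½ A d(p_{2g+1}²)`, a polynomial in `z²`. -/
lemma p_mul_pDeriv_mem (hU : IsOpen U)
    (hd : ∀ j i, ∀ x ∈ U, DifferentiableAt 𝕜 (fun y => H y j i) x)
    (hW : ∀ x ∈ U, IsPointWgc g (H x)) {x : Fin (2 * g + 1) → 𝕜} (hx : x ∈ U) {j : ℤ}
    (hj : (g : ℤ) ≤ j) (u : Fin (2 * g + 1) → 𝕜) :
    p g (H x) (2 * g + 1) * pDeriv g H (2 * j + 1) x u ∈ evenPolynomials := by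
  obtain ⟨A, hA, hpA⟩ := (hW x hx).exists_p_eq_mul hj
  have h1 := deriv_p_mul_p_mem hU hd hW hx hj u
  have h2 := mul_mem (C_mem_evenPolynomials (1 / 2))
    (deriv_p_mul_p_mem hU hd hW hx (le_refl (g : ℤ)) u)
  have h3 := sub_mem h1 (mul_mem hA h2)
  convert! h3 using 1
  have hhalf : (C (1 / 2 : ℂ) : LaurentSeries ℂ) * 2 = 1 := by
    rw [← map_ofNat (C : ℂ →+* LaurentSeries ℂ) 2, ← map_mul]
    norm_num
  rw [hpA]
  linear_combination (A * pDeriv g H (2 * g + 1) x u * p g (H x) (2 * g + 1)) * hhalf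

/-- Once the coefficients of `ω(z)` down to `z^{-2g-1}` are closed, all of them are. -/
lemma isClosedOneFormOn_omega_of_low (hU : IsOpen U)
    (hd : ∀ j i, ∀ x ∈ U, DifferentiableAt 𝕜 (fun y => H y j i) x)
    (hW : ∀ x ∈ U, IsPointWgc g (H x))
    (hlow : ∀ i : ℤ, Odd i → 1 - 2 * (g : ℤ) ≤ i → i ≤ 2 * (g : ℤ) + 1 →
      IsClosedOneFormOn (omega g H i) U) {i : ℤ} (hi : Odd i) (hi' : 1 - 2 * (g : ℤ) ≤ i) :
    IsClosedOneFormOn (omega g H i) U := by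
  intro x hx
  refine (extDeriv_ofSubsingleton_eq_zero_iff
    (differentiableAt_omega fun j => hd j i x hx)).mpr fun u v => ?_
  -- the series of the values on `(u, v)` of the coefficients of `dω(z)`
  set f : LaurentSeries ℂ := ∑ k, (C (algebraMap 𝕜 ℂ (v k)) * pDeriv g H (idx g k) x u
    - C (algebraMap 𝕜 ℂ (u k)) * pDeriv g H (idx g k) x v) with hf
  have hcoeff : ∀ n : ℤ, Odd n → 1 - 2 * (g : ℤ) ≤ n →
      f.coeff n = fderiv 𝕜 (omega g H n) x u v - fderiv 𝕜 (omega g H n) x v u := by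
    intro n hn hn'
    rw [fderiv_omega_apply (fun j => hd j n x hx), fderiv_omega_apply (fun j => hd j n x hx), hf,
      HahnSeries.coeff_sum, ← Finset.sum_sub_distrib]
    simp only [HahnSeries.coeff_sub, coeff_C_mul, pDeriv, coeff_oddTail, if_pos (And.intro hn hn')]
  have hcoeff0 : ∀ n : ℤ, ¬ (Odd n ∧ 1 - 2 * (g : ℤ) ≤ n) → f.coeff n = 0 := by
    intro n hn
    rw [hf, HahnSeries.coeff_sum]
    simp only [HahnSeries.coeff_sub, coeff_C_mul, pDeriv, coeff_oddTail, if_neg hn, mul_zero,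
      sub_zero, Finset.sum_const_zero]
  have hf0 : f = 0 := by
    refine eq_zero_of_p_mul_mem (H := H x) (g := g) ?_ ?_
    · rw [hf, Finset.mul_sum]
      refine sum_mem fun k _ => ?_
      have hk (w : Fin (2 * g + 1) → 𝕜) :=
        p_mul_pDeriv_mem hU hd hW hx (by lia : (g : ℤ) ≤ g + (k : ℕ)) w
      rw [mul_sub, mul_left_comm, mul_left_comm _ (C _)]
      exact sub_mem (mul_mem (C_mem_evenPolynomials _) (hk u))
        (mul_mem (C_mem_evenPolynomials _) (hk v))
    · intro n hn
      by_cases hn' : Odd n ∧ 1 - 2 * (g : ℤ) ≤ n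
      · rw [hcoeff n hn'.1 hn'.2, sub_eq_zero]
        exact (extDeriv_ofSubsingleton_eq_zero_iff
          (differentiableAt_omega fun j => hd j n x hx)).mp
            (hlow n hn'.1 hn'.2 (by grind) x hx) u v
      · exact hcoeff0 n hn'
  have := hcoeff i hi hi'
  rw [hf0, HahnSeries.coeff_zero] at this
  exact (sub_eq_zero.mp this.symm)

lemma omegaZ_eq_omega {n : ℤ} (hn : Odd n) (hn' : 1 - 2 * (g : ℤ) ≤ n) :
    omegaZ g H n = omega g H n := by
  funext x
  unfold omegaZ omega
  congr 1
  funext k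
  rw [coeff_p, if_pos (And.intro hn hn'), if_neg (by unfold idx; lia : ¬ n = -idx g k), zero_add]

lemma isClosedOneFormOn_omegaZ_of_not {n : ℤ} (hn : ¬ (Odd n ∧ 1 - 2 * (g : ℤ) ≤ n)) :
    IsClosedOneFormOn (omegaZ g H n) U := by
  intro x _
  have hconst : omegaZ g H n = fun _ => omegaZ g H n x := by
    funext y
    simp only [omegaZ, coeff_p, if_neg hn]
  rw [hconst]
  refine (extDeriv_ofSubsingleton_eq_zero_iff (differentiableAt_const _)).mpr fun u v => ?_
  simp

/-! ### The action -/

/-- The Poincaré lemma on a convex open set. -/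
lemma exists_hasFDerivAt_of_isClosedOneFormOn {m : ℕ} {V : Set (Fin m → 𝕜)} (hVo : IsOpen V)
    (hV : Convex ℝ V)
    {ω : (Fin m → 𝕜) → (Fin m → 𝕜) →L[𝕜] ℂ} (hd : DifferentiableOn 𝕜 ω V)
    (hω : IsClosedOneFormOn ω V) :
    ∃ f : (Fin m → 𝕜) → ℂ, ∀ x ∈ V, HasFDerivAt f (ω x) x := by
  refine hV.exists_forall_hasFDerivAt_of_fderiv_symmetric hVo (hd.restrictScalars ℝ) ?_
  intro a ha u v
  have hda := hd.differentiableAt (hVo.mem_nhds ha)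
  rw [hda.fderiv_restrictScalars ℝ]
  exact (extDeriv_ofSubsingleton_eq_zero_iff hda).mp (hω a ha) u v

lemma coordForm_single {m : ℕ} (a : Fin m → ℂ) (k : Fin m) :
    coordForm a (Pi.single k (1 : 𝕜)) = a k := by
  rw [coordForm_apply, Finset.sum_eq_single k]
  · simp
  · intro l _ hl
    simp [hl]
  · simp

/-- Primitives of the coefficients `ω_i` assemble to a primitive of `ω(z)`. -/
lemma hasFDerivAt_coeff_action {S : ℤ → (Fin (2 * g + 1) → 𝕜) → ℂ} {x : Fin (2 * g + 1) → 𝕜}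
    (hS : ∀ i : ℤ, Odd i → 1 - 2 * (g : ℤ) ≤ i → HasFDerivAt (S i) (omega g H i x) x) (n : ℤ) :
    HasFDerivAt (fun y => (action g S y).coeff n) (omegaZ g H n x) x := by
  have hfun : (fun y => (action g S y).coeff n) = fun y =>
      coordForm (fun k => if n = -idx g k then (1 : ℂ) else 0) y
        + if Odd n ∧ 1 - 2 * (g : ℤ) ≤ n then S n y else 0 := by
    funext y
    rw [action, HahnSeries.coeff_add, HahnSeries.coeff_sum, coeff_oddTail, coordForm_apply]
    congr 1
    refine Finset.sum_congr rfl fun k _ => ?_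
    rw [HahnSeries.coeff_single]
    split_ifs <;> simp
  have hform : omegaZ g H n x =
      (coordForm (fun k => if n = -idx g k then (1 : ℂ) else 0) : (Fin (2 * g + 1) → 𝕜) →L[𝕜] ℂ)
        + if Odd n ∧ 1 - 2 * (g : ℤ) ≤ n then omega g H n x else 0 := by
    ext v
    simp only [omegaZ, _root_.add_apply, coordForm_apply, coeff_p, mul_add,
      Finset.sum_add_distrib]
    congr 1
    split_ifs
    · rw [omega, coordForm_apply]
    · simp
  rw [hfun, hform]
  refine (ContinuousLinearMap.hasFDerivAt _).add ?_
  split_ifs with h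
  · exact hS n h.1 h.2
  · exact hasFDerivAt_const _ _

end Analysis

end BirkhoffStratum

theorem mainTheorem3 {𝕜 : Type*} [RCLike 𝕜] [NormedAlgebra 𝕜 ℂ] (g : ℕ)
    (U : Set (Fin (2 * g + 1) → 𝕜)) (hU : IsOpen U)
    (H : (Fin (2 * g + 1) → 𝕜) → ℤ → ℤ → ℂ)
    (hsmooth : ∀ j i : ℤ, ContDiffOn 𝕜 1 (fun x => H x j i) U)
    (hW : ∀ x ∈ U, BirkhoffStratum.IsPointWgc g (H x)) :
    -- closedness of the first `2g+1` forms implies closedness of all the higher ones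
    ((∀ i : ℤ, Odd i → 1 - 2 * (g : ℤ) ≤ i → i ≤ 2 * (g : ℤ) + 1 →
        BirkhoffStratum.IsClosedOneFormOn (BirkhoffStratum.omega g H i) U) →
      ∀ i : ℤ, Odd i → 2 * (g : ℤ) + 3 ≤ i →
        BirkhoffStratum.IsClosedOneFormOn (BirkhoffStratum.omega g H i) U) ∧
    -- closedness of the first `2g+1` forms is equivalent to closedness of `ω(z)`
    ((∀ i : ℤ, Odd i → 1 - 2 * (g : ℤ) ≤ i → i ≤ 2 * (g : ℤ) + 1 →
        BirkhoffStratum.IsClosedOneFormOn (BirkhoffStratum.omega g H i) U) ↔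
      ∀ n : ℤ, BirkhoffStratum.IsClosedOneFormOn (BirkhoffStratum.omegaZ g H n) U) ∧
    -- then, locally, `ω(z) = dS`, `p_{2j+1}(z) = ∂S/∂x_{2j+1}` and `H^{2j+1}_i = ∂S_i/∂x_{2j+1}`
    ((∀ i : ℤ, Odd i → 1 - 2 * (g : ℤ) ≤ i → i ≤ 2 * (g : ℤ) + 1 →
        BirkhoffStratum.IsClosedOneFormOn (BirkhoffStratum.omega g H i) U) →
      ∀ x₀ ∈ U, ∃ V : Set (Fin (2 * g + 1) → 𝕜), IsOpen V ∧ x₀ ∈ V ∧ V ⊆ U ∧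
        ∃ S : ℤ → (Fin (2 * g + 1) → 𝕜) → ℂ, ∀ x ∈ V,
          (∀ n : ℤ, HasFDerivAt (fun y => (BirkhoffStratum.action g S y).coeff n)
            (BirkhoffStratum.omegaZ g H n x) x) ∧
          (∀ (k : Fin (2 * g + 1)) (n : ℤ),
            HasLineDerivAt 𝕜 (fun y => (BirkhoffStratum.action g S y).coeff n)
              ((BirkhoffStratum.p g (H x) (BirkhoffStratum.idx g k)).coeff n) x (Pi.single k 1)) ∧
          (∀ (k : Fin (2 * g + 1)) (i : ℤ), Odd i → 1 - 2 * (g : ℤ) ≤ i →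
            HasLineDerivAt 𝕜 (S i) (H x (BirkhoffStratum.idx g k) i) x (Pi.single k 1))) := by
  have hd : ∀ j i, ∀ x ∈ U, DifferentiableAt 𝕜 (fun y => H y j i) x := fun j i x hx =>
    ((hsmooth j i).differentiableOn one_ne_zero).differentiableAt (hU.mem_nhds hx)
  have hall := fun hlow i hi hi' =>
    BirkhoffStratum.isClosedOneFormOn_omega_of_low (i := i) hU hd hW hlow hi hi'
  refine ⟨fun hlow i hi hi' => hall hlow i hi (by lia), ⟨fun hlow n => ?_, fun h i hi hi' _ => ?_⟩,
    fun hlow x₀ hx₀ => ?_⟩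
  · by_cases hn : Odd n ∧ 1 - 2 * (g : ℤ) ≤ n
    · rw [BirkhoffStratum.omegaZ_eq_omega hn.1 hn.2]
      exact hall hlow n hn.1 hn.2
    · exact BirkhoffStratum.isClosedOneFormOn_omegaZ_of_not hn
  · rw [← BirkhoffStratum.omegaZ_eq_omega hi hi']
    exact h i
  · obtain ⟨r, hr, hball⟩ := Metric.isOpen_iff.mp hU x₀ hx₀
    have hex : ∀ i : ℤ, ∃ f : (Fin (2 * g + 1) → 𝕜) → ℂ, Odd i → 1 - 2 * (g : ℤ) ≤ i →
        ∀ x ∈ Metric.ball x₀ r, HasFDerivAt f (BirkhoffStratum.omega g H i x) x := by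
      intro i
      by_cases hi : Odd i ∧ 1 - 2 * (g : ℤ) ≤ i
      · obtain ⟨f, hf⟩ := BirkhoffStratum.exists_hasFDerivAt_of_isClosedOneFormOn
          Metric.isOpen_ball (convex_ball x₀ r)
          (fun x hx => (BirkhoffStratum.differentiableAt_omega
            fun j => hd j i x (hball hx)).differentiableWithinAt)
          (fun x hx => hall hlow i hi.1 hi.2 x (hball hx))
        exact ⟨f, fun _ _ => hf⟩
      · exact ⟨0, fun h h' => absurd ⟨h, h'⟩ hi⟩
    choose S hS using hex
    refine ⟨Metric.ball x₀ r, Metric.isOpen_ball, Metric.mem_ball_self hr, hball, S,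
      fun x hx => ?_⟩
    have hact := BirkhoffStratum.hasFDerivAt_coeff_action (g := g) (H := H) (S := S) (x := x)
      (fun i hi hi' => hS i hi hi' x hx)
    refine ⟨hact, fun k n => ?_, fun k i hi hi' => ?_⟩
    · have := (hact n).hasLineDerivAt (Pi.single k 1)
      rwa [BirkhoffStratum.omegaZ, BirkhoffStratum.coordForm_single] at this
    · have := (hS i hi hi' x hx).hasLineDerivAt (Pi.single k 1)
      rwa [BirkhoffStratum.omega, BirkhoffStratum.coordForm_single] at this
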